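/- For an integer $n\ge 2$ let $\mathfrak C_n=\{0,\dots,n-1\}^{\mathbb N}$ be the Cantor space of infinite words (with the product topology), and call a finite set $S$ of finite words over $\{0,\dots,n-1\}$ a prefix code if every $\zeta\in\mathfrak C_n$ has exactly one prefix in $S$. Let $\operatorname{Sym}(n)$ act on $\mathfrak C_n$ letter by letter. For $H\le\operatorname{Sym}(n)$ let $V_n(H)$ be the group, under composition, of all homeomorphisms $f$ of $\mathfrak C_n$ for which there are prefix codes $\{p_1,\dots,p_k\}$ and $\{q_1,\dots,q_k\}$ (each with $k$ distinct elements) and $\sigma_1,\dots,\sigma_k,\tau_1,\dots,\tau_k\in H$ such that $f(p_i\,\sigma_i(u))=q_i\,\tau_i(u)$ for all $i\in\{1,\dots,k\}$ and all $u\in\mathfrak C_n$. Let $2\le m\le n$ be integers with $n\equiv m \pmod{m-1}$, and let $G\le\operatorname{Sym}(m)$. Then there exists a subgroup $H\le\operatorname{Sym}(n)$ such that $V_m(G)$ embeds in $V_n(H)$, that is, there is an injective group homomorphism $V_m(G)\to V_n(H)$. -/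

import Mathlib

namespace SymThompson

/-- The Cantor space `𝔠_n` of infinite words over the alphabet `{0, …, n-1}`, with the product of the
discrete topologies. -/
abbrev Cantor (n : ℕ) : Type := ℕ → Fin n

/-- Concatenation of a finite word with an infinite word. -/
def concat {n : ℕ} (p : List (Fin n)) (u : Cantor n) : Cantor n :=
  fun i => if h : i < p.length then p[i] else u (i - p.length)

/-- The finite word `p` is a prefix of the infinite word `ζ`. -/
def IsPrefixOf {n : ℕ} (p : List (Fin n)) (ζ : Cantor n) : Prop :=
  ∃ u : Cantor n, ζ = concat p u

/-- A (complete) prefix code: a finite set of finite words such that every infinite word has exactly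
one prefix in the set. -/
def IsPrefixCode {n : ℕ} (S : Set (List (Fin n))) : Prop :=
  S.Finite ∧ ∀ ζ : Cantor n, ∃! s, s ∈ S ∧ IsPrefixOf s ζ

/-- A permutation of the alphabet, applied to every letter of an infinite word. -/
def letterwise {n : ℕ} (σ : Equiv.Perm (Fin n)) (u : Cantor n) : Cantor n :=
  fun i => σ (u i)

/-- A table over `H ≤ Sym(n)`: columns `(p_i, σ_i, q_i, τ_i)` such that the `p_i` are distinct and
form a prefix code, likewise the `q_i`, and `σ_i, τ_i ∈ H`. -/
structure Table (n : ℕ) (H : Subgroup (Equiv.Perm (Fin n))) where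
  len : ℕ
  p : Fin len → List (Fin n)
  σ : Fin len → H
  q : Fin len → List (Fin n)
  τ : Fin len → H
  p_injective : Function.Injective p
  q_injective : Function.Injective q
  p_code : IsPrefixCode (Set.range p)
  q_code : IsPrefixCode (Set.range q)

/-- The homeomorphism `f` is the one described by the table `t`:
it sends `p_i σ_i(u)` to `q_i τ_i(u)` for every column `i` and every infinite word `u`. -/
def Table.Describes {n : ℕ} {H : Subgroup (Equiv.Perm (Fin n))} (t : Table n H)
    (f : Cantor n ≃ₜ Cantor n) : Prop :=
  ∀ (i : Fin t.len) (u : Cantor n),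
    f (concat (t.p i) (letterwise (t.σ i : Equiv.Perm (Fin n)) u)) =
      concat (t.q i) (letterwise (t.τ i : Equiv.Perm (Fin n)) u)

/-! ### Facts needed to see that the homeomorphisms described by tables form a group -/

lemma concat_append {n : ℕ} (p w : List (Fin n)) (u : Cantor n) :
    concat (p ++ w) u = concat p (concat w u) := by
  funext i
  simp only [concat, List.length_append, List.getElem_append]
  split_ifs <;> first | rfl | omega | (congr 1; omega)

lemma letterwise_concat {n : ℕ} (σ : Equiv.Perm (Fin n)) (p : List (Fin n)) (u : Cantor n) :
    letterwise σ (concat p u) = concat (p.map σ) (letterwise σ u) := by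
  funext i
  simp only [concat, letterwise, List.length_map, List.getElem_map]
  split_ifs <;> rfl

lemma letterwise_mul {n : ℕ} (σ τ : Equiv.Perm (Fin n)) (u : Cantor n) :
    letterwise (σ * τ) u = letterwise σ (letterwise τ u) := rfl

lemma letterwise_one {n : ℕ} (u : Cantor n) :
    letterwise (1 : Equiv.Perm (Fin n)) u = u := rfl

lemma letterwise_inv_self {n : ℕ} (σ : Equiv.Perm (Fin n)) (u : Cantor n) :
    letterwise σ⁻¹ (letterwise σ u) = u := by
  funext i; simp [letterwise]

lemma letterwise_self_inv {n : ℕ} (σ : Equiv.Perm (Fin n)) (u : Cantor n) :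
    letterwise σ (letterwise σ⁻¹ u) = u := by
  funext i; simp [letterwise]

lemma concat_take {n : ℕ} (N : ℕ) (ζ : Cantor n) :
    concat (List.ofFn fun i : Fin N => ζ i) (fun i => ζ (N + i)) = ζ := by
  funext i
  simp only [concat, List.length_ofFn, List.getElem_ofFn]
  split_ifs
  · rfl
  · congr 1; omega

lemma concat_ofFn_inj {n N : ℕ} {v w : Fin N → Fin n} {x y : Cantor n}
    (h : concat (List.ofFn v) x = concat (List.ofFn w) y) : v = w := by
  funext i
  have := congrFun h i
  simpa [concat] using this

/-- A homeomorphism that acts, on every cone at level `N`, by a prefix replacement followed by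
an element of `H`, is described by a table. -/
lemma exists_table_of_level {n : ℕ} {H : Subgroup (Equiv.Perm (Fin n))} (f : Cantor n ≃ₜ Cantor n)
    (N : ℕ) (hf : ∀ w : Fin N → Fin n, ∃ (q : List (Fin n)) (τ : H), ∀ u : Cantor n,
      f (concat (List.ofFn w) u) = concat q (letterwise (τ : Equiv.Perm (Fin n)) u)) :
    ∃ t : Table n H, t.Describes f := by
  choose q τ h using hf
  have key : ∀ v w : Fin N → Fin n, ∀ x y : Cantor n, concat (q v) x = concat (q w) y → v = w := by
    intro v w x y hxy
    have hv := h v (letterwise (τ v : Equiv.Perm (Fin n))⁻¹ x)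
    have hw := h w (letterwise (τ w : Equiv.Perm (Fin n))⁻¹ y)
    rw [letterwise_self_inv] at hv hw
    exact concat_ofFn_inj (f.injective (hv.trans (hxy.trans hw.symm)))
  have qinj : Function.Injective q := by
    intro v w hvw
    by_contra hne
    obtain ⟨i, -⟩ := Function.ne_iff.1 hne
    exact hne (key v w (fun _ => v i) (fun _ => v i) (by rw [hvw]))
  let e := (Fintype.equivFin (Fin N → Fin n)).symm
  refine ⟨⟨Fintype.card (Fin N → Fin n), fun i => List.ofFn (e i), fun _ => 1, fun i => q (e i),
    fun i => τ (e i), fun i j hij => e.injective (List.ofFn_injective hij),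
    fun i j hij => e.injective (qinj hij), ⟨Set.finite_range _, fun ζ => ?_⟩,
    ⟨Set.finite_range _, fun ζ => ?_⟩⟩, fun i u => h (e i) u⟩
  · refine ⟨List.ofFn fun i : Fin N => ζ i,
      ⟨⟨e.symm fun i : Fin N => ζ i, by simp⟩, _, (concat_take N ζ).symm⟩, ?_⟩
    rintro _ ⟨⟨j, rfl⟩, u, hu⟩
    have := concat_ofFn_inj ((concat_take N ζ).trans hu)
    exact congrArg List.ofFn this.symm
  · obtain ⟨ξ, rfl⟩ := f.surjective ζ
    let w : Fin N → Fin n := fun i => ξ i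
    have hw := h w (fun i => ξ (N + i))
    rw [concat_take] at hw
    refine ⟨q w, ⟨⟨e.symm w, by simp⟩, _, hw⟩, ?_⟩
    rintro _ ⟨⟨j, rfl⟩, u, hu⟩
    exact congrArg q (key _ _ _ _ (hw.symm.trans hu)).symm

/-- A homeomorphism described by a table acts on every sufficiently small cone by a prefix
replacement followed by an element of `H`, and shortens prefixes by a bounded amount. -/
lemma Table.Describes.level {n : ℕ} {H : Subgroup (Equiv.Perm (Fin n))} {t : Table n H}
    {f : Cantor n ≃ₜ Cantor n} (h : t.Describes f) :
    ∃ D : ℕ, ∀ w : List (Fin n), D ≤ w.length → ∃ (q : List (Fin n)) (τ : H),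
      w.length ≤ q.length + D ∧
      ∀ u : Cantor n, f (concat w u) = concat q (letterwise (τ : Equiv.Perm (Fin n)) u) := by
  obtain ⟨D, hD⟩ : ∃ D : ℕ, ∀ i, (t.p i).length ≤ D :=
    ⟨Finset.univ.sup fun i => (t.p i).length, fun i =>
      Finset.le_sup (f := fun i => (t.p i).length) (Finset.mem_univ i)⟩
  refine ⟨D, fun w hw => ?_⟩
  by_cases hn : IsEmpty (Cantor n)
  · exact ⟨w, 1, by omega, fun u => hn.elim u⟩
  rw [not_isEmpty_iff] at hn
  obtain ⟨u₀⟩ := hn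
  obtain ⟨_, ⟨⟨i, rfl⟩, x, hx⟩, -⟩ := t.p_code.2 (concat w u₀)
  have hi : (t.p i).length ≤ w.length := (hD i).trans hw
  have hpre : w = t.p i ++ w.drop (t.p i).length := by
    have : w.take (t.p i).length = t.p i := by
      apply List.ext_getElem
      · simp [hi]
      · intro k h1 h2
        have := congrFun hx k
        simp only [concat, h2, dif_pos, lt_of_lt_of_le h2 hi] at this
        simpa using this
    conv_lhs => rw [← List.take_append_drop (t.p i).length w, this]
  set w' := w.drop (t.p i).length
  refine ⟨t.q i ++ w'.map ((t.τ i * (t.σ i)⁻¹ : H) : Equiv.Perm (Fin n)), t.τ i * (t.σ i)⁻¹, ?_,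
    fun u => ?_⟩
  · have h1 := congrArg List.length hpre
    have h2 := hD i
    simp only [List.length_append, List.length_map] at h1 ⊢
    omega
  · have h1 := h i (letterwise ((t.σ i : Equiv.Perm (Fin n))⁻¹) (concat w' u))
    rw [letterwise_self_inv, ← concat_append, ← hpre, ← letterwise_mul] at h1
    rw [h1, concat_append, ← letterwise_concat]
    rfl

/-- The symmetric Thompson group `V_n(H)`: the group, under composition, of all homeomorphisms of
the Cantor space `𝔠_n` that are described by a table over `H`. -/
def V (n : ℕ) (H : Subgroup (Equiv.Perm (Fin n))) : Subgroup (Cantor n ≃ₜ Cantor n) where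
  carrier := {f | ∃ t : Table n H, t.Describes f}
  one_mem' := exists_table_of_level 1 0 fun w => ⟨List.ofFn w, 1, fun _ => rfl⟩
  mul_mem' := by
    rintro f g ⟨t, ht⟩ ⟨s, hs⟩
    obtain ⟨D, hD⟩ := ht.level
    obtain ⟨E, hE⟩ := hs.level
    refine exists_table_of_level (f * g) (D + E) fun w => ?_
    obtain ⟨q, τ, hq, h1⟩ := hE (List.ofFn w) (by simp)
    obtain ⟨r, ρ, -, h2⟩ := hD q (by simp at hq; omega)
    refine ⟨r, ρ * τ, fun u => ?_⟩
    change f (g _) = _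
    rw [h1, h2]
    rfl
  inv_mem' := by
    rintro f ⟨t, ht⟩
    refine ⟨⟨t.len, t.q, t.τ, t.p, t.σ, t.q_injective, t.p_injective, t.q_code, t.p_code⟩, ?_⟩
    intro i u
    exact (Homeomorph.symm_apply_eq f).2 (ht i u).symm

end SymThompson

/-! Even `H = ⊥` suffices. Near each `ζ`, an element `f` of `V m G` applies a well-defined `germ f
ζ` in `G` to tails, and this germ is a cocycle. So `V m G` acts on `G × 𝔠_m` compatibly with `(g, u)
↦ g u`, and in these coordinates the letter permutations cancel (`isGerm_viaEmbedding`). Placing the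
finitely many copies of `𝔠_m` on disjoint cones that miss the zero word, and extending by the
identity, embeds `V m G` in the pure prefix replacements fixing that word
(`exists_embedding_pointedReplacements`).

To pass to `n = m + (m - 1) c` letters, attach `c` copies of `𝔠_n` to each nonzero finitely
supported word over `m` letters. Pointed prefix replacements permute these words, hence act on the
blowup, carrying the attached copies along unchanged. The blowup is `𝔠_n` itself (`blowupEquiv`):
cut a word at its first new letter `(a, l)`; the letters before it, then `a` and zeros, form the
finitely supported word, `l` names the copy and the rest is a point of it. In this coding the action
is again by prefix replacements (`changeAlphabet_mem`), and compactness (`exists_uniform_level`)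
yields tables. -/

namespace SymThompson

open Function

/-! ### Germs of prefix replacements -/

/-- Near `ζ`, the map `f` replaces a prefix of fixed length by another one and applies `τ` to every
later letter. -/
def IsGerm {n : ℕ} (f : Cantor n → Cantor n) (ζ : Cantor n) (τ : Equiv.Perm (Fin n)) : Prop :=
  ∃ N M : ℕ, ∀ ξ : Cantor n, (∀ i < N, ξ i = ζ i) →
    (∀ i < M, f ξ i = f ζ i) ∧ ∀ i, f ξ (M + i) = τ (ξ (N + i))

section Germ

variable {n : ℕ}

/-- Both prefixes may be lengthened by the same amount, which brings two local descriptions to a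
common depth. -/
lemma germ_bounds_add {f : Cantor n → Cantor n} {ζ : Cantor n} {τ : Equiv.Perm (Fin n)} {N M : ℕ}
    (h : ∀ ξ : Cantor n, (∀ i < N, ξ i = ζ i) →
      (∀ i < M, f ξ i = f ζ i) ∧ ∀ i, f ξ (M + i) = τ (ξ (N + i))) (k : ℕ)
    (ξ : Cantor n) (hξ : ∀ i < N + k, ξ i = ζ i) :
    (∀ i < M + k, f ξ i = f ζ i) ∧ ∀ i, f ξ (M + k + i) = τ (ξ (N + k + i)) := by
  have h1 := h ξ fun i hi => hξ i (by omega)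
  have h2 := h ζ fun i _ => rfl
  refine ⟨fun i hi => ?_, fun i => by rw [add_assoc, h1.2, add_assoc]⟩
  by_cases hM : i < M
  · exact h1.1 i hM
  · obtain ⟨j, rfl⟩ := Nat.exists_eq_add_of_le (not_lt.1 hM)
    rw [h1.2, h2.2, hξ _ (by omega)]

/-- This is the local constancy of the germ. -/
lemma IsGerm.of_agree {f : Cantor n → Cantor n} {ζ : Cantor n} {τ : Equiv.Perm (Fin n)}
    {N M : ℕ} (h : ∀ ξ : Cantor n, (∀ i < N, ξ i = ζ i) →
      (∀ i < M, f ξ i = f ζ i) ∧ ∀ i, f ξ (M + i) = τ (ξ (N + i)))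
    {η : Cantor n} (hη : ∀ i < N, η i = ζ i) : IsGerm f η τ := by
  refine ⟨N, M, fun ξ hξ => ?_⟩
  have h1 := h ξ fun i hi => (hξ i hi).trans (hη i hi)
  exact ⟨fun i hi => (h1.1 i hi).trans ((h η hη).1 i hi).symm, h1.2⟩

lemma isGerm_one (ζ : Cantor n) : IsGerm id ζ 1 :=
  ⟨0, 0, fun _ _ => ⟨fun _ hi => absurd hi (Nat.not_lt_zero _), fun _ => rfl⟩⟩

lemma IsGerm.comp {f g : Cantor n → Cantor n} {ζ : Cantor n} {σ τ : Equiv.Perm (Fin n)}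
    (hf : IsGerm f (g ζ) σ) (hg : IsGerm g ζ τ) : IsGerm (f ∘ g) ζ (σ * τ) := by
  obtain ⟨N, M, h⟩ := hg
  obtain ⟨N', M', h'⟩ := hf
  refine ⟨N + N', M' + M, fun ξ hξ => ?_⟩
  have h1 := germ_bounds_add h N' ξ hξ
  have h2 := germ_bounds_add h' M (g ξ) fun i hi => h1.1 i (by omega)
  refine ⟨h2.1, fun i => ?_⟩
  have h3 := h1.2 i
  rw [add_comm M N'] at h3
  rw [comp_apply, h2.2, h3, Equiv.Perm.mul_apply]

/-- Compare two descriptions at a common input depth. If the output depths differed, one would force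
a letter that the other makes `σ a` for arbitrary `a`, impossible with two letters available. -/
lemma IsGerm.unique (hn : 2 ≤ n) {f : Cantor n → Cantor n} {ζ : Cantor n}
    {σ τ : Equiv.Perm (Fin n)} (hσ : IsGerm f ζ σ) (hτ : IsGerm f ζ τ) : σ = τ := by
  obtain ⟨N, M, h⟩ := hσ
  obtain ⟨N', M', h'⟩ := hτ
  wlog hle : M + N' ≤ M' + N generalizing σ τ N M N' M'
  · exact (this N' M' h' N M h (by omega)).symm
  have h1 : ∀ u : Cantor n, ∀ i, _ := fun u => (germ_bounds_add h N'
    (fun i => if i < N + N' then ζ i else u (i - (N + N'))) fun i hi => if_pos hi).2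
  have h2 := fun u : Cantor n => germ_bounds_add h' N
    (fun i => if i < N + N' then ζ i else u (i - (N + N')))
    fun i hi => if_pos (by omega)
  simp only [Nat.add_comm N' N, add_lt_iff_neg_left, not_lt_zero, if_false,
    Nat.add_sub_cancel_left] at h1 h2
  obtain hlt | heq := hle.lt_or_eq
  · exfalso
    have h3 : ∀ a : Fin n, σ a = f ζ (M + N') := fun a => by
      rw [← (h2 fun _ => a).1 _ hlt]
      simpa using (h1 (fun _ => a) 0).symm
    have := σ.injective ((h3 ⟨0, by omega⟩).trans (h3 ⟨1, by omega⟩).symm)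
    simp at this
  · ext a
    have h3 := h1 (fun _ => a) 0
    rw [heq, (h2 fun _ => a).2 0] at h3
    exact congrArg Fin.val h3.symm

lemma IsGerm.inv {f : Equiv.Perm (Cantor n)} {ζ : Cantor n} {τ : Equiv.Perm (Fin n)}
    (h : IsGerm f ζ τ) : IsGerm (f⁻¹ : Equiv.Perm (Cantor n)) (f ζ) τ⁻¹ := by
  obtain ⟨N, M, h⟩ := h
  refine ⟨M, N, fun η hη => ?_⟩
  -- The preimage of `η`, found by undoing the prefix replacement and `τ`.
  let ξ : Cantor n := fun i => if i < N then ζ i else τ⁻¹ (η (M + (i - N)))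
  have h1 := h ξ fun i hi => if_pos hi
  have h2 : f ξ = η := by
    funext i
    by_cases hM : i < M
    · rw [h1.1 i hM, hη i hM]
    · obtain ⟨j, rfl⟩ := Nat.exists_eq_add_of_le (not_lt.1 hM)
      rw [h1.2]
      simp [ξ]
  have h3 : (f⁻¹ : Equiv.Perm (Cantor n)) η = ξ := Equiv.Perm.inv_eq_iff_eq.2 h2.symm
  rw [h3, show (f⁻¹ : Equiv.Perm (Cantor n)) (f ζ) = ζ from f.symm_apply_apply ζ]
  exact ⟨fun i hi => if_pos hi, fun i => by simp [ξ]⟩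

lemma exists_isGerm {H : Subgroup (Equiv.Perm (Fin n))} (f : V n H) (ζ : Cantor n) :
    ∃ τ : H, IsGerm (f : Cantor n ≃ₜ Cantor n) ζ τ := by
  obtain ⟨f, t, ht⟩ := f
  obtain ⟨D, hD⟩ := ht.level
  obtain ⟨q, τ, -, h⟩ := hD (List.ofFn fun i : Fin D => ζ i) (by simp)
  have key : ∀ ξ : Cantor n, (∀ i < D, ξ i = ζ i) →
      f ξ = concat q (letterwise (τ : Equiv.Perm (Fin n)) fun i => ξ (D + i)) := by
    intro ξ hξ
    rw [← h]
    conv_lhs => rw [← concat_take D ξ]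
    congr 3
    funext i
    exact hξ i i.2
  refine ⟨τ, D, q.length, fun ξ hξ => ?_⟩
  change (∀ i < _, f ξ i = f ζ i) ∧ ∀ i, f ξ _ = _
  rw [key ξ hξ, key ζ fun _ _ => rfl]
  exact ⟨fun i hi => by simp [concat, hi], fun i => by simp [concat, letterwise]⟩

/-! ### From local prefix replacements to tables -/

/-- The permutations of the Cantor space that are locally prefix replacements. -/
def prefixReplacements (n : ℕ) : Subgroup (Equiv.Perm (Cantor n)) where
  carrier := {f | ∀ ζ, IsGerm f ζ 1}
  one_mem' := isGerm_one
  mul_mem' := fun {f g} hf hg ζ => by simpa using (hf (g ζ)).comp (hg ζ)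
  inv_mem' := fun {f} hf ζ => by simpa using (hf (f⁻¹ ζ)).inv

lemma isOpen_cylinder (ζ : Cantor n) (N : ℕ) : IsOpen {ξ : Cantor n | ∀ i < N, ξ i = ζ i} := by
  have : {ξ : Cantor n | ∀ i < N, ξ i = ζ i} =
      ⋂ i ∈ Finset.range N, (fun ξ : Cantor n => ξ i) ⁻¹' {ζ i} := by ext; simp
  rw [this]
  exact isOpen_biInter_finset fun i _ => (continuous_apply i).isOpen_preimage _ (isOpen_discrete _)

lemma exists_uniform_level {f : Cantor n → Cantor n} (hf : ∀ ζ, IsGerm f ζ 1) :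
    ∃ N, ∀ ζ, ∃ M, ∀ ξ : Cantor n, (∀ i < N, ξ i = ζ i) →
      (∀ i < M, f ξ i = f ζ i) ∧ ∀ i, f ξ (M + i) = ξ (N + i) := by
  choose N M h using hf
  obtain ⟨s, hs⟩ := isCompact_univ.elim_finite_subcover _ (fun ζ => isOpen_cylinder ζ (N ζ))
    fun ξ _ => Set.mem_iUnion.2 ⟨ξ, fun _ _ => rfl⟩
  refine ⟨s.sup N, fun η => ?_⟩
  obtain ⟨ζ, hζ, hη⟩ := Set.mem_iUnion₂.1 (hs (Set.mem_univ η))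
  obtain ⟨k, hk⟩ := Nat.exists_eq_add_of_le (Finset.le_sup (f := N) hζ)
  rw [hk]
  refine ⟨M ζ + k, germ_bounds_add (τ := 1) (fun ξ hξ => ?_) k⟩
  have h1 := h ζ ξ fun i hi => (hξ i hi).trans (hη i hi)
  exact ⟨fun i hi => (h1.1 i hi).trans ((h ζ η hη).1 i hi).symm, h1.2⟩

lemma continuous_of_isGerm {f : Cantor n → Cantor n} (hf : ∀ ζ, IsGerm f ζ 1) :
    Continuous f := by
  refine continuous_pi fun j => (IsLocallyConstant.iff_exists_open _).2 (fun ζ => ?_) |>.continuous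
  obtain ⟨N, M, h⟩ := hf ζ
  exact ⟨_, isOpen_cylinder ζ (N + (j + 1)), fun _ _ => rfl,
    fun ξ hξ => (germ_bounds_add h (j + 1) ξ hξ).1 j (by omega)⟩

/-- A permutation that is locally a prefix replacement, as a homeomorphism. -/
def toHomeomorph (f : prefixReplacements n) : Cantor n ≃ₜ Cantor n :=
  (continuous_of_isGerm f.2).homeoOfEquivCompactToT2

lemma toHomeomorph_mem [NeZero n] (H : Subgroup (Equiv.Perm (Fin n)))
    (f : prefixReplacements n) : toHomeomorph f ∈ V n H := by
  obtain ⟨N, h⟩ := exists_uniform_level f.2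
  refine exists_table_of_level _ N fun w => ?_
  -- Padding `w` by zeros gives a reference point from which the new prefix is read off.
  obtain ⟨M, hM⟩ := h (concat (List.ofFn w) 0)
  refine ⟨List.ofFn fun i : Fin M => f.1 (concat (List.ofFn w) 0) i, 1, fun u => ?_⟩
  have h1 := hM (concat (List.ofFn w) u) fun i hi => by simp [concat, hi]
  change f.1 _ = _
  conv_lhs => rw [← concat_take M (f.1 _)]
  congr 1
  · congr 1
    funext i
    exact h1.1 i i.2
  · funext i
    simp [h1.2, concat, letterwise]

/-- The prefix replacements embed in every `V n H`. -/
def prefixReplacementsHom [NeZero n] (H : Subgroup (Equiv.Perm (Fin n))) :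
    prefixReplacements n →* V n H :=
  MonoidHom.mk' (fun f => ⟨toHomeomorph f, toHomeomorph_mem H f⟩) fun _ _ => rfl

lemma prefixReplacementsHom_injective [NeZero n] (H : Subgroup (Equiv.Perm (Fin n))) :
    Injective (prefixReplacementsHom H) := by
  intro f g h
  ext1
  ext1 ζ
  exact DFunLike.congr_fun (congrArg Subtype.val h) ζ

end Germ

/-! ### Removing the letter permutations -/

section Cocycle

variable {m : ℕ} {G : Subgroup (Equiv.Perm (Fin m))}

/-- The element of `G` by which `f` acts on the tails of the words near `ζ`. -/
noncomputable def germ (f : V m G) (ζ : Cantor m) : G := (exists_isGerm f ζ).choose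

lemma isGerm_germ (f : V m G) (ζ : Cantor m) :
    IsGerm (f : Cantor m ≃ₜ Cantor m) ζ (germ f ζ) := (exists_isGerm f ζ).choose_spec

lemma germ_eq (hm : 2 ≤ m) {f : V m G} {ζ : Cantor m} {τ : G}
    (h : IsGerm (f : Cantor m ≃ₜ Cantor m) ζ τ) : germ f ζ = τ :=
  Subtype.ext ((isGerm_germ f ζ).unique hm h)

lemma germ_mul (hm : 2 ≤ m) (f g : V m G) (ζ : Cantor m) :
    germ (f * g) ζ = germ f ((g : Cantor m ≃ₜ Cantor m) ζ) * germ g ζ :=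
  germ_eq hm ((isGerm_germ f _).comp (isGerm_germ g ζ))

/-- The lift of `f` along `G × 𝔠_m → 𝔠_m`, `(g, ζ) ↦ g ζ`, that acts by prefix replacements. -/
noncomputable def lift (f : V m G) (x : G × Cantor m) : G × Cantor m :=
  let y := letterwise (x.1 : Equiv.Perm (Fin m)) x.2
  let g := germ f y * x.1
  (g, letterwise (g⁻¹ : Equiv.Perm (Fin m)) ((f : Cantor m ≃ₜ Cantor m) y))

lemma lift_mul (hm : 2 ≤ m) (f g : V m G) (x : G × Cantor m) :
    lift (f * g) x = lift f (lift g x) := by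
  simp only [lift, letterwise_self_inv, germ_mul hm, mul_assoc]
  rfl

lemma lift_one (hm : 2 ≤ m) (x : G × Cantor m) : lift (1 : V m G) x = x := by
  have h : ∀ ζ, germ (1 : V m G) ζ = 1 := fun ζ => germ_eq hm (isGerm_one ζ)
  simp only [lift, h, one_mul]
  exact Prod.ext rfl (letterwise_inv_self _ _)

/-- The action of `V m G` on `G × 𝔠_m` by lifts. -/
noncomputable def liftHom (hm : 2 ≤ m) : V m G →* Equiv.Perm (G × Cantor m) :=
  letI : MulAction (V m G) (G × Cantor m) :=
    { smul := lift, one_smul := lift_one hm, mul_smul := lift_mul hm }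
  MulAction.toPermHom _ _

/-- If the lift fixes `(1, ζ)`, then the germ at `ζ` is trivial, and so `f` fixes `ζ`. -/
lemma liftHom_injective (hm : 2 ≤ m) : Injective (liftHom (G := G) hm) := by
  refine (injective_iff_map_eq_one _).2 fun f hf => ?_
  ext1
  ext1 ζ
  have h : lift f (1, ζ) = (1, ζ) := Equiv.congr_fun hf (1, ζ)
  have h1 := congrArg Prod.fst h
  have h2 := congrArg Prod.snd h
  simp only [lift, mul_one] at h1 h2
  rw [h1] at h2
  exact h2

/-- Places the copies of the Cantor space indexed by `G` on cones at level `L`. -/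
def cone {L : ℕ} (κ : G → Fin L → Fin m) (x : G × Cantor m) : Cantor m :=
  concat (List.ofFn (κ x.1)) x.2

lemma cone_of_lt {L : ℕ} (κ : G → Fin L → Fin m) (x : G × Cantor m) {i : ℕ} (hi : i < L) :
    cone κ x i = κ x.1 ⟨i, hi⟩ := by simp [cone, concat, hi]

lemma cone_add {L : ℕ} (κ : G → Fin L → Fin m) (x : G × Cantor m) (i : ℕ) :
    cone κ x (L + i) = x.2 i := by simp [cone, concat]

lemma cone_injective {L : ℕ} {κ : G → Fin L → Fin m} (hκ : Injective κ) :
    Injective (cone κ) := fun x y h =>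
  Prod.ext (hκ (concat_ofFn_inj h)) (funext fun i => by rw [← cone_add κ, h, cone_add])

lemma eq_cone {L : ℕ} {κ : G → Fin L → Fin m} {g : G} {ξ : Cantor m}
    (h : ∀ i : Fin L, ξ i = κ g i) : ξ = cone κ (g, fun i => ξ (L + i)) := by
  funext i
  by_cases hi : i < L
  · rw [cone_of_lt _ _ hi, ← h ⟨i, hi⟩]
  · obtain ⟨j, rfl⟩ := Nat.exists_eq_add_of_le (not_lt.1 hi)
    rw [cone_add]

/-- On the copy indexed by `g`, with `τ` the germ of `f`, the tail undergoes `(τ g)⁻¹ τ g = 1`. -/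
lemma isGerm_viaEmbedding (hm : 2 ≤ m) {L : ℕ} {κ : G → Fin L → Fin m} (hκ : Injective κ)
    (f : V m G) (ξ : Cantor m) :
    IsGerm ((liftHom hm f).viaEmbedding ⟨cone κ, cone_injective hκ⟩) ξ 1 := by
  set F := (liftHom hm f).viaEmbedding ⟨cone κ, cone_injective hκ⟩
  have hF : ∀ x, F (cone κ x) = cone κ (lift f x) :=
    Equiv.Perm.viaEmbedding_apply (liftHom hm f) ⟨cone κ, cone_injective hκ⟩
  by_cases hξ : ∃ g, ∀ i : Fin L, ξ i = κ g i
  · obtain ⟨g, hg⟩ := hξ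
    set ζ : Cantor m := letterwise (g : Equiv.Perm (Fin m)) fun i => ξ (L + i) with hζ
    obtain ⟨N, M, h⟩ := isGerm_germ f ζ
    have key : ∀ ξ' : Cantor m, (∀ i < L + N, ξ' i = ξ i) →
        F ξ' = cone κ (germ f ζ * g, letterwise ((germ f ζ * g : G)⁻¹ : Equiv.Perm (Fin m))
          ((f : Cantor m ≃ₜ Cantor m)
            (letterwise (g : Equiv.Perm (Fin m)) fun i => ξ' (L + i)))) := by
      intro ξ' h'
      have h1 : germ f (letterwise (g : Equiv.Perm (Fin m)) fun i => ξ' (L + i)) = germ f ζ := by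
        refine germ_eq hm (IsGerm.of_agree h fun i hi => ?_)
        simp [hζ, letterwise, h' (L + i) (by omega)]
      conv_lhs => rw [eq_cone fun i => (h' i (by omega)).trans (hg i), hF]
      simp only [lift, h1]
    refine ⟨L + N, L + M, fun ξ' h' => ?_⟩
    have h2 := h (letterwise (g : Equiv.Perm (Fin m)) fun i => ξ' (L + i)) fun i hi => by
      simp [hζ, letterwise, h' (L + i) (by omega)]
    rw [key ξ' h', key ξ fun _ _ => rfl]
    refine ⟨fun i hi => ?_, fun i => ?_⟩
    · by_cases hL : i < L
      · rw [cone_of_lt _ _ hL, cone_of_lt _ _ hL]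
      · obtain ⟨j, rfl⟩ := Nat.exists_eq_add_of_le (not_lt.1 hL)
        rw [cone_add, cone_add]
        exact congrArg ((germ f ζ * g : G)⁻¹ : Equiv.Perm (Fin m)) (h2.1 j (by omega))
    · rw [add_assoc, cone_add]
      simp only [letterwise] at h2 ⊢
      rw [h2.2 i]
      simp [add_assoc]
  · refine ⟨L, L, fun ξ' h' => ?_⟩
    have hfix : ∀ η : Cantor m, (∀ i < L, η i = ξ i) → F η = η := by
      intro η hη
      refine Equiv.Perm.viaEmbedding_apply_of_notMem _ _ _ ?_
      rintro ⟨x, rfl⟩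
      refine hξ ⟨x.1, fun i => ?_⟩
      rw [← hη i i.2]
      exact cone_of_lt κ x i.2
    rw [hfix ξ' h', hfix ξ fun _ _ => rfl]
    exact ⟨h', fun _ => rfl⟩

/-- The permutations of the Cantor space that are locally prefix replacements and fix the zero
word. -/
def pointedReplacements (m : ℕ) [NeZero m] : Subgroup (Equiv.Perm (Cantor m)) :=
  prefixReplacements m ⊓ MulAction.stabilizer (Equiv.Perm (Cantor m)) (0 : Cantor m)

lemma exists_nonzero_code [NeZero m] (hm : 2 ≤ m) (G : Subgroup (Equiv.Perm (Fin m))) :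
    ∃ (L : ℕ) (κ : G → Fin L → Fin m), Injective κ ∧ ∀ g, κ g ≠ 0 := by
  classical
  -- Any `L` with `|G| < m ^ L` leaves enough nonzero words.
  let L := Fintype.card G
  have hcard : Fintype.card G ≤ Fintype.card {w : Fin L → Fin m // w ≠ 0} := by
    have h1 : Fintype.card {w : Fin L → Fin m // w ≠ 0} = m ^ L - 1 := by
      simp [Fintype.card_subtype_compl]
    have h2 : L < m ^ L := Nat.lt_pow_self (by omega)
    omega
  obtain ⟨e⟩ := Embedding.nonempty_of_card_le hcard
  exact ⟨L, fun g => (e g).1, Subtype.val_injective.comp e.injective, fun g => (e g).2⟩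

lemma exists_embedding_pointedReplacements [NeZero m] (hm : 2 ≤ m)
    (G : Subgroup (Equiv.Perm (Fin m))) :
    ∃ Φ : V m G →* pointedReplacements m, Injective Φ := by
  obtain ⟨L, κ, hκ, hκ0⟩ := exists_nonzero_code hm G
  let Φ := (Equiv.Perm.viaEmbeddingHom ⟨cone κ, cone_injective hκ⟩).comp (liftHom (G := G) hm)
  have hΦ : Injective Φ :=
    (Equiv.Perm.viaEmbeddingHom_injective _).comp (liftHom_injective hm)
  refine ⟨Φ.codRestrict _ fun f => ⟨isGerm_viaEmbedding hm hκ f, ?_⟩,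
    fun f g h => hΦ (congrArg Subtype.val h)⟩
  refine Equiv.Perm.viaEmbedding_apply_of_notMem _ _ _ ?_
  rintro ⟨x, hx⟩
  refine hκ0 x.1 (funext fun i => ?_)
  rw [← cone_of_lt κ x i.2]
  exact congrFun hx i

end Cocycle

/-! ### From `m` letters to `n` letters -/

section ChangeOfAlphabet

variable {m n c : ℕ} [NeZero m]

/-- The nonzero infinite words with finitely many nonzero letters. -/
abbrev FinSupp (m : ℕ) [NeZero m] : Type :=
  {x : Cantor m // x ≠ 0 ∧ ∃ K, ∀ i ≥ K, x i = 0}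

lemma exists_last (x : FinSupp m) : ∃ K, x.1 K ≠ 0 ∧ ∀ i > K, x.1 i = 0 := by
  classical
  obtain ⟨x, hx, h⟩ := x
  have hK := Nat.find_spec h
  have hmin := fun k => Nat.find_min h (m := k)
  rcases hk : Nat.find h with _ | k
  · rw [hk] at hK
    exact absurd (funext fun i => hK i (Nat.zero_le i)) hx
  · rw [hk] at hK hmin
    refine ⟨_, fun h0 => hmin _ (Nat.lt_succ_self _) fun i hi => ?_, fun i hi => hK i hi⟩
    obtain heq | hlt := (Nat.lt_or_eq_of_le hi).symm
    · exact heq ▸ h0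
    · exact hK i hlt

/-- The position of the last nonzero letter. -/
noncomputable def FinSupp.last (x : FinSupp m) : ℕ := (exists_last x).choose

lemma FinSupp.apply_last (x : FinSupp m) : x.1 x.last ≠ 0 := (exists_last x).choose_spec.1

lemma FinSupp.apply_of_gt (x : FinSupp m) : ∀ i > x.last, x.1 i = 0 :=
  (exists_last x).choose_spec.2

lemma FinSupp.last_eq (x : FinSupp m) {K : ℕ} (h : x.1 K ≠ 0) (h' : ∀ i > K, x.1 i = 0) :
    x.last = K := by
  rcases lt_trichotomy x.last K with hlt | heq | hgt
  · exact absurd (x.apply_of_gt _ hlt) h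
  · exact heq
  · exact absurd (h' _ hgt) x.apply_last

lemma eventually_zero_of_isGerm {f : Cantor m → Cantor m} {x : Cantor m} (hf : IsGerm f x 1)
    (hx : ∃ K, ∀ i ≥ K, x i = 0) : ∃ K, ∀ i ≥ K, f x i = 0 := by
  obtain ⟨N, M, h⟩ := hf
  obtain ⟨K, hK⟩ := hx
  refine ⟨M + K, fun i hi => ?_⟩
  obtain ⟨j, rfl⟩ := Nat.exists_eq_add_of_le hi
  rw [add_assoc, (h x fun _ _ => rfl).2]
  exact hK _ (by omega)

/-- The action of pointed prefix replacements on nonzero words of finite support. -/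
def FinSupp.map (f : pointedReplacements m) (x : FinSupp m) : FinSupp m :=
  ⟨f.1 x.1, fun h => x.2.1 (f.1.injective (h.trans (show f.1 0 = 0 from f.2.2).symm)),
    eventually_zero_of_isGerm (f.2.1 x.1) x.2.2⟩

/-- The Cantor space over `m` letters together with `c` cones over `n` letters for each nonzero
word of finite support. -/
abbrev Blowup (m n c : ℕ) [NeZero m] : Type := Cantor m ⊕ FinSupp m × Fin c × Cantor n

/-- The action of pointed prefix replacements on the blowup. -/
def blowupHom (m n c : ℕ) [NeZero m] : pointedReplacements m →* Equiv.Perm (Blowup m n c) :=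
  letI : MulAction (pointedReplacements m) (Blowup m n c) :=
    { smul := fun f => Sum.map f.1 (Prod.map (FinSupp.map f) id)
      one_smul := fun z => by rcases z with z | z <;> rfl
      mul_smul := fun f g z => by rcases z with z | z <;> rfl }
  MulAction.toPermHom _ _

lemma blowupHom_inl (f : pointedReplacements m) (ζ : Cantor m) :
    blowupHom m n c f (Sum.inl ζ) = Sum.inl (f.1 ζ) := rfl

lemma blowupHom_inr (f : pointedReplacements m) (x : FinSupp m) (l : Fin c) (t : Cantor n) :
    blowupHom m n c f (Sum.inr (x, l, t)) = Sum.inr (x.map f, l, t) := rfl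

lemma blowupHom_injective : Injective (blowupHom m n c) := fun f g h =>
  Subtype.ext (Equiv.ext fun ζ =>
    Sum.inl_injective (Equiv.congr_fun h (Sum.inl ζ) : Sum.inl (f.1 ζ) = Sum.inl (g.1 ζ)))

variable (A : Fin m ⊕ ({i : Fin m // i ≠ 0} × Fin c) ≃ Fin n)

/-- The coding of the blowup by words over `n` letters: `n - m` of the letters record the last
nonzero letter of a word of finite support and one of its `c` cones. -/
noncomputable def blowupCode : Blowup m n c → Cantor n
  | Sum.inl ζ => fun i => A (Sum.inl (ζ i))
  | Sum.inr (x, l, t) => fun i =>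
      if i < x.last then A (Sum.inl (x.1 i))
      else if i = x.last then A (Sum.inr (⟨x.1 x.last, x.apply_last⟩, l))
      else t (i - (x.last + 1))

lemma blowupCode_inl (ζ : Cantor m) (i : ℕ) :
    blowupCode A (Sum.inl ζ) i = A (Sum.inl (ζ i)) := rfl

variable (x : FinSupp m) (l : Fin c) (t : Cantor n)

lemma blowupCode_of_lt {i : ℕ} (hi : i < x.last) :
    blowupCode A (Sum.inr (x, l, t)) i = A (Sum.inl (x.1 i)) := if_pos hi

lemma blowupCode_last :
    blowupCode A (Sum.inr (x, l, t)) x.last =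
      A (Sum.inr (⟨x.1 x.last, x.apply_last⟩, l)) := by
  simp [blowupCode]

lemma blowupCode_last_add (i : ℕ) :
    blowupCode A (Sum.inr (x, l, t)) (x.last + 1 + i) = t i := by
  simp only [blowupCode]
  rw [if_neg (by omega), if_neg (by omega), Nat.add_sub_cancel_left]

lemma eq_blowupCode {ξ : Cantor n} (h1 : ∀ i < x.last, ξ i = A (Sum.inl (x.1 i)))
    (h2 : ξ x.last = A (Sum.inr (⟨x.1 x.last, x.apply_last⟩, l))) :
    ξ = blowupCode A (Sum.inr (x, l, fun i => ξ (x.last + 1 + i))) := by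
  funext i
  rcases lt_trichotomy i x.last with hlt | rfl | hgt
  · rw [h1 i hlt, blowupCode_of_lt A x l _ hlt]
  · rw [h2, blowupCode_last]
  · obtain ⟨j, rfl⟩ := Nat.exists_eq_add_of_le (Nat.succ_le_of_lt hgt)
    exact (blowupCode_last_add A x l (fun i => ξ (x.last + 1 + i)) j).symm

lemma blowupCode_last_le {y : FinSupp m} {k : Fin c} {s : Cantor n}
    (h : blowupCode A (Sum.inr (x, l, t)) = blowupCode A (Sum.inr (y, k, s))) :
    y.last ≤ x.last := by
  by_contra hlt
  have h1 := congrFun h x.last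
  rw [blowupCode_last, blowupCode_of_lt A y k s (not_le.1 hlt)] at h1
  cases A.injective h1

lemma blowupCode_injective : Injective (blowupCode A) := by
  rintro (ζ | ⟨x, l, t⟩) (η | ⟨y, k, s⟩) h
  · exact congrArg Sum.inl (funext fun i => Sum.inl_injective (A.injective (congrFun h i)))
  · have h1 := congrFun h y.last
    rw [blowupCode_last] at h1
    cases A.injective h1
  · have h1 := congrFun h x.last
    rw [blowupCode_last] at h1
    cases A.injective h1
  · have hlast : x.last = y.last :=
      le_antisymm (blowupCode_last_le A y k s h.symm) (blowupCode_last_le A x l t h)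
    have h1 := congrFun h x.last
    rw [blowupCode_last, congrArg (blowupCode A (Sum.inr (y, k, s))) hlast, blowupCode_last] at h1
    have h2 := Sum.inr_injective (A.injective h1)
    have h3 : x.1 y.last = y.1 y.last := by
      simpa [hlast] using congrArg (fun z => z.1.1) h2
    have hxy : x = y := Subtype.ext <| funext fun i => by
      rcases lt_trichotomy i y.last with hlt | rfl | hgt
      · have h4 := congrFun h i
        rw [blowupCode_of_lt A x l t (hlast ▸ hlt), blowupCode_of_lt A y k s hlt] at h4
        exact Sum.inl_injective (A.injective h4)
      · exact h3
      · rw [x.apply_of_gt i (hlast ▸ hgt), y.apply_of_gt i hgt]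
    subst hxy
    have hl : l = k := congrArg Prod.snd h2
    have ht : t = s := funext fun i => by
      rw [← blowupCode_last_add A x l t, h, blowupCode_last_add]
    rw [hl, ht]

/-- Split according to whether a new letter occurs, and decode at its first occurrence. -/
lemma blowupCode_surjective : Surjective (blowupCode A) := by
  classical
  intro ξ
  by_cases h : ∃ i z, ξ i = A (Sum.inr z)
  · obtain ⟨⟨a, l⟩, hz⟩ := Nat.find_spec h
    have hmin := fun i hi => Nat.find_min h (m := i) hi
    set K := Nat.find h
    have hlt : ∀ i < K, ∃ b, ξ i = A (Sum.inl b) := by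
      intro i hi
      rcases hb : A.symm (ξ i) with b | z
      · exact ⟨b, by rw [← hb, Equiv.apply_symm_apply]⟩
      · exact absurd ⟨z, by rw [← hb, Equiv.apply_symm_apply]⟩ (hmin i hi)
    choose b hb using hlt
    let v : Cantor m := fun i => if hi : i < K then b i hi else if i = K then a.1 else 0
    have hvK : v K = a.1 := by simp [v]
    have hv : ∀ i > K, v i = 0 := fun i hi => by
      simp only [v]
      rw [dif_neg (by omega), if_neg (by omega)]
    let x : FinSupp m := ⟨v, fun h0 => a.2 (by rw [← hvK, h0]; rfl), K + 1, fun i hi => hv i hi⟩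
    have hx : x.last = K := x.last_eq (by rw [show x.1 K = a.1 from hvK]; exact a.2) hv
    refine ⟨_, (eq_blowupCode A x l (fun i hi => ?_) ?_).symm⟩
    · rw [hx] at hi
      rw [hb i hi]
      simp [x, v, hi]
    · have : (⟨x.1 x.last, x.apply_last⟩ : {i : Fin m // i ≠ 0}) = a :=
        Subtype.ext ((congrArg x.1 hx).trans hvK)
      rw [this, hx, hz]
  · push Not at h
    have hlt : ∀ i, ∃ b, ξ i = A (Sum.inl b) := by
      intro i
      rcases hb : A.symm (ξ i) with b | z
      · exact ⟨b, by rw [← hb, Equiv.apply_symm_apply]⟩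
      · exact absurd (by rw [← hb, Equiv.apply_symm_apply]) (h i z)
    choose b hb using hlt
    exact ⟨Sum.inl b, funext fun i => (hb i).symm⟩

/-- The blowup is the Cantor space over `n` letters. -/
noncomputable def blowupEquiv : Blowup m n c ≃ Cantor n :=
  Equiv.ofBijective (blowupCode A) ⟨blowupCode_injective A, blowupCode_surjective A⟩

/-- The action of pointed prefix replacements on the Cantor space over `n` letters. -/
noncomputable def changeAlphabet : pointedReplacements m →* Equiv.Perm (Cantor n) :=
  (blowupEquiv A).permCongrHom.toMonoidHom.comp (blowupHom m n c)

lemma changeAlphabet_injective : Injective (changeAlphabet A) :=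
  (blowupEquiv A).permCongrHom.injective.comp blowupHom_injective

lemma changeAlphabet_inl (f : pointedReplacements m) (ζ : Cantor m) :
    changeAlphabet A f (blowupCode A (Sum.inl ζ)) = blowupCode A (Sum.inl (f.1 ζ)) := by
  rw [← blowupHom_inl (n := n) (c := c)]
  exact congrArg (fun z => blowupEquiv A (blowupHom m n c f z))
    ((blowupEquiv A).symm_apply_apply (Sum.inl ζ))

lemma changeAlphabet_inr (f : pointedReplacements m) :
    changeAlphabet A f (blowupCode A (Sum.inr (x, l, t))) =
      blowupCode A (Sum.inr (x.map f, l, t)) := by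
  rw [← blowupHom_inr]
  exact congrArg (fun z => blowupEquiv A (blowupHom m n c f z))
    ((blowupEquiv A).symm_apply_apply (Sum.inr (x, l, t)))

/-- The code of `ζ` has no new letters, so a nearby point in an attached copy sits at some `x` that
agrees with `ζ` up to `N` and has its last nonzero letter at `N + k`. Then `f` moves that letter to
`M + k`: the bounds `N`, `M` of `f` at `ζ` serve for the coding too. -/
lemma isGerm_changeAlphabet_inl (f : pointedReplacements m) (ζ : Cantor m) :
    IsGerm (changeAlphabet A f) (blowupCode A (Sum.inl ζ)) 1 := by
  obtain ⟨N, M, h⟩ := f.2.1 ζ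
  refine ⟨N, M, fun ξ hξ => ?_⟩
  obtain ⟨η | ⟨x, l, t⟩, rfl⟩ := blowupCode_surjective A ξ
  · have h1 := h η fun i hi => Sum.inl_injective (A.injective (hξ i hi))
    simp only [changeAlphabet_inl, blowupCode_inl]
    exact ⟨fun i hi => by rw [h1.1 i hi], fun i => by rw [h1.2 i]; rfl⟩
  · have hN : N ≤ x.last := by
      by_contra hlt
      have h1 := hξ x.last (not_le.1 hlt)
      rw [blowupCode_last] at h1
      cases A.injective h1
    have h1 := h x.1 fun i hi => by
      have h2 := hξ i hi
      rw [blowupCode_of_lt A x l t (by omega)] at h2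
      exact Sum.inl_injective (A.injective h2)
    obtain ⟨k, hk⟩ := Nat.exists_eq_add_of_le hN
    have hlast : (x.map f).last = M + k := by
      refine FinSupp.last_eq _ ?_ fun i hi => ?_
      · change f.1 x.1 (M + k) ≠ 0
        rw [h1.2, ← hk]
        exact x.apply_last
      · obtain ⟨j, rfl⟩ := Nat.exists_eq_add_of_le (show M ≤ i by omega)
        change f.1 x.1 (M + j) = 0
        rw [h1.2]
        exact x.apply_of_gt _ (by omega)
    rw [changeAlphabet_inl, changeAlphabet_inr]
    refine ⟨fun i hi => ?_, fun i => ?_⟩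
    · rw [blowupCode_inl, ← h1.1 i hi]
      by_cases hi' : i < (x.map f).last
      · exact blowupCode_of_lt A _ l t hi'
      · omega
    · rw [Equiv.Perm.one_apply]
      rcases lt_trichotomy i k with hlt | rfl | hgt
      · rw [blowupCode_of_lt A _ l t (by omega), blowupCode_of_lt A _ l t (by omega)]
        exact congrArg (fun a => A (Sum.inl a)) (h1.2 i)
      · rw [← hlast, blowupCode_last, ← hk, blowupCode_last]
        congr 4
        rw [hlast, hk]
        exact h1.2 i
      · obtain ⟨j, rfl⟩ := Nat.exists_eq_add_of_le (Nat.succ_le_of_lt hgt)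
        rw [show M + (k + 1 + j) = (x.map f).last + 1 + j by omega,
          show N + (k + 1 + j) = x.last + 1 + j by omega, blowupCode_last_add,
          blowupCode_last_add]

/-- The letters up to and including the new one determine `x` and `l`, so a whole cone is carried to
a whole cone. -/
lemma isGerm_changeAlphabet_inr (f : pointedReplacements m) :
    IsGerm (changeAlphabet A f) (blowupCode A (Sum.inr (x, l, t))) 1 := by
  refine ⟨x.last + 1, (x.map f).last + 1, fun ξ hξ => ?_⟩
  rw [eq_blowupCode A x l
    (fun i hi => (hξ i (by omega)).trans (blowupCode_of_lt A x l t hi))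
    ((hξ _ (by omega)).trans (blowupCode_last A x l t)), changeAlphabet_inr, changeAlphabet_inr]
  refine ⟨fun i hi => ?_, fun i => ?_⟩
  · obtain hlt | rfl := Nat.lt_succ_iff_lt_or_eq.1 hi
    · rw [blowupCode_of_lt A _ l _ hlt, blowupCode_of_lt A _ l _ hlt]
    · rw [blowupCode_last, blowupCode_last]
  · rw [blowupCode_last_add, Equiv.Perm.one_apply, blowupCode_last_add]

lemma changeAlphabet_mem (f : pointedReplacements m) :
    changeAlphabet A f ∈ prefixReplacements n := by
  intro ξ
  obtain ⟨ζ | ⟨x, l, t⟩, rfl⟩ := blowupCode_surjective A ξ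
  · exact isGerm_changeAlphabet_inl A f ζ
  · exact isGerm_changeAlphabet_inr A x l t f

/-- The congruence of `m` and `n` enters here: new letters come in `c` families of `m - 1`, one
letter for each possible last nonzero letter. -/
lemma nonempty_alphabet_equiv (h : n = m + (m - 1) * c) :
    Nonempty (Fin m ⊕ ({i : Fin m // i ≠ 0} × Fin c) ≃ Fin n) := by
  classical
  refine ⟨Fintype.equivOfCardEq ?_⟩
  simp [Fintype.card_subtype_compl, h]

end ChangeOfAlphabet

end SymThompson

theorem mainTheorem3 (m n : ℕ) (hm : 2 ≤ m) (hmn : m ≤ n) (hmod : n ≡ m [MOD (m - 1)])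
    (G : Subgroup (Equiv.Perm (Fin m))) :
    ∃ H : Subgroup (Equiv.Perm (Fin n)),
      ∃ ι : SymThompson.V m G →* SymThompson.V n H, Function.Injective ι := by
  have : NeZero m := ⟨by omega⟩
  have : NeZero n := ⟨by omega⟩
  obtain ⟨c, hc⟩ := (Nat.modEq_iff_dvd' hmn).1 hmod.symm
  obtain ⟨A⟩ := SymThompson.nonempty_alphabet_equiv (m := m) (n := n) (c := c) (by omega)
  obtain ⟨Φ, hΦ⟩ := SymThompson.exists_embedding_pointedReplacements hm G
  let Ψ := (SymThompson.changeAlphabet A).codRestrict _ (SymThompson.changeAlphabet_mem A)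
  have hΨ : Function.Injective Ψ := fun f g h =>
    SymThompson.changeAlphabet_injective A (congrArg Subtype.val h)
  exact ⟨⊥, (SymThompson.prefixReplacementsHom ⊥).comp (Ψ.comp Φ),
    (SymThompson.prefixReplacementsHom_injective ⊥).comp (hΨ.comp hΦ)⟩
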